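/- Let \((X,d)\) be a complete separable metric space and let \(\mathfrak m\) be a non-negative Borel measure on \(X\) that is finite on bounded Borel sets. Let \(p\in[1,\infty)\), let \(q\in(1,\infty]\) be the conjugate exponent, \(\frac1p+\frac1q=1\), and let \(\lambda\in\{0,1\}\). Equip \(C([0,1];X)\) with the supremum distance, and let \(R([0,1];X)\) be the set of rectifiable (i.e. continuous and of finite length \(\ell(\gamma)\)) curves. For \(\gamma\in R([0,1];X)\) let \(s_\gamma\) be the Borel measure on \([0,1]\) with \(s_\gamma([a,b])=\ell(\gamma|_{[a,b]})\) for all \(0\le a\le b\le1\), and put \(\int_\gamma\rho\,ds:=\int_0^1\rho(\gamma_t)\,ds_\gamma(t)\) for Borel \(\rho\colon X\to[0,\infty]\). For \(\Gamma\subseteq R([0,1];X)\) define the modulus \[ \mathrm{Mod}_p^\lambda(\Gamma):=\inf\Big\{\int\rho^p\,d\mathfrak m\ \Big|\ \rho\colon X\to[0,\infty]\text{ Borel},\ \lambda\big(\rho(\gamma_0)+\rho(\gamma_1)\big)+\int_\gamma\rho\,ds\ge1\ \text{ for every }\gamma\in\Gamma\Big\} \] (with \(0\cdot\infty=0\) and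 \(\inf\varnothing=\infty\)). For a finite Borel measure \(\pi\) on \(C([0,1];X)\) concentrated on \(R([0,1];X)\), let \[ \Pi^\lambda_\pi:=\lambda(\mathrm e_0)_\#\pi+\lambda(\mathrm e_1)_\#\pi+\int\gamma_\#s_\gamma\,d\pi(\gamma),\qquad \mathrm e_t(\gamma):=\gamma_t ; \] one says that \(\pi\) admits \(\lambda\)-barycenter in \(L^q(\mathfrak m)\) if \(\Pi^\lambda_\pi\ll\mathfrak m\) and \(\mathrm{Bar}_\lambda(\pi):=\frac{d\Pi^\lambda_\pi}{d\mathfrak m}\in L^q(\mathfrak m)\). Let \(\Gamma\subseteq R([0,1];X)\) be compact with \(0<\mathrm{Mod}_p^\lambda(\Gamma)<\infty\). Then there exists a Borel probability measure \(\pi_\Gamma\) on \(C([0,1];X)\), concentrated on \(\Gamma\), that admits \(\lambda\)-barycenter in \(L^q(\mathfrak m)\), with \[ \|\mathrm{Bar}_\lambda(\pi_\Gamma)\|_{L^q(\mathfrak m)}=\mathrm{Mod}_p^\lambda(\Gamma)^{-1/p}. \] -/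

import Mathlib

open MeasureTheory Set Topology
open scoped ENNReal unitInterval

noncomputable section

namespace CurveModulus

variable {X : Type*} [MetricSpace X]

/-- The space of curves `C([0,1]; X)` carries the topology of uniform convergence; measures on it
are Borel measures. -/
instance : MeasurableSpace C(I, X) := borel C(I, X)

instance : BorelSpace C(I, X) := ⟨rfl⟩

/-- The length of a curve: the supremum of its variations over all partitions of `[0,1]`. -/
def length (γ : C(I, X)) : ℝ≥0∞ := eVariationOn γ univ

/-- A curve is rectifiable if its length is finite. -/
def IsRectifiable (γ : C(I, X)) : Prop := length γ ≠ ∞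

/-- The length function `t ↦ ℓ(γ|_{[0,t]})` of a rectifiable curve. -/
def lengthFunction (γ : C(I, X)) (hγ : IsRectifiable γ) : StieltjesFunction I where
  toFun t := (eVariationOn γ (Icc 0 t)).toReal
  mono' s t hst := ENNReal.toReal_mono
    (ne_top_of_le_ne_top hγ (eVariationOn.mono γ (subset_univ _)))
    (eVariationOn.mono γ (Icc_subset_Icc_right hst))
  right_continuous' x := by
    have hb : BoundedVariationOn γ univ := hγ
    have h := hb.continuousWithinAt_variationOnFromTo_Ici (a := 0)
      (γ.continuous.continuousWithinAt (s := Ici x) (x := x))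
    have he : variationOnFromTo γ univ (0 : I) =
        fun t : I => (eVariationOn γ (Icc 0 t)).toReal := by
      ext t
      rw [variationOnFromTo.eq_of_le γ univ t.2.1, univ_inter]
    rwa [he] at h

open Classical in
/-- The total variation measure `s_γ` on `[0,1]` of a rectifiable curve: the Lebesgue–Stieltjes
measure of its length function. (The value `0` for a non-rectifiable curve is a dummy.) -/
def variationMeasure (γ : C(I, X)) : Measure I :=
  if hγ : IsRectifiable γ then (lengthFunction γ hγ).measure else 0

open Classical in
/-- The path integral `∫_γ ρ ds`, with value `∞` along non-rectifiable curves. -/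
def pathIntegral (ρ : X → ℝ≥0∞) (γ : C(I, X)) : ℝ≥0∞ :=
  if IsRectifiable γ then ∫⁻ t, ρ (γ t) ∂(variationMeasure γ) else ∞

/-- The variation measure gives every subinterval the length of the corresponding subcurve. -/
theorem variationMeasure_Icc (γ : C(I, X)) (hγ : IsRectifiable γ) {a b : I} (hab : a ≤ b) :
    variationMeasure γ (Icc a b) = eVariationOn γ (Icc a b) := by
  have hfin : ∀ s : Set I, eVariationOn γ s ≠ ∞ := fun s =>
    ne_top_of_le_ne_top hγ (eVariationOn.mono γ (subset_univ s))
  have hadd : ∀ {c d : I}, c ≤ d → eVariationOn γ (Icc 0 c) + eVariationOn γ (Icc c d)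
      = eVariationOn γ (Icc 0 d) := by
    intro c d hcd
    have := eVariationOn.Icc_add_Icc γ (s := univ) (a := 0) (b := c) (c := d) c.2.1 hcd
      (mem_univ c)
    simpa using this
  have hlim : Function.leftLim (lengthFunction γ hγ) a = lengthFunction γ hγ a := by
    rcases Filter.eq_or_neBot (𝓝[<] a) with h | h
    · exact leftLim_eq_of_eq_bot _ h
    · refine leftLim_eq_of_tendsto ?_
      have hb : BoundedVariationOn γ univ := hγ
      have h0 := hb.tendsto_eVariationOn_Icc_zero_left (x := a)
        (γ.continuous.continuousWithinAt)
      have h1 := (ENNReal.tendsto_toReal ENNReal.zero_ne_top).comp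
        (h0.mono_left (nhdsWithin_mono a (subset_univ (Iio a))))
      have h2 := (tendsto_const_nhds (x := lengthFunction γ hγ a)).sub h1
      simp only [ENNReal.toReal_zero, sub_zero] at h2
      refine h2.congr' ?_
      filter_upwards [self_mem_nhdsWithin] with y hy
      have hya : y ≤ a := le_of_lt hy
      have := congrArg ENNReal.toReal (hadd hya)
      rw [ENNReal.toReal_add (hfin _) (hfin _)] at this
      change (eVariationOn γ (Icc 0 a)).toReal - (eVariationOn γ (univ ∩ Icc y a)).toReal
        = (eVariationOn γ (Icc 0 y)).toReal
      rw [univ_inter]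
      linarith
  rw [variationMeasure, dif_pos hγ, StieltjesFunction.measure_Icc, hlim]
  have := congrArg ENNReal.toReal (hadd hab)
  rw [ENNReal.toReal_add (hfin _) (hfin _)] at this
  change ENNReal.ofReal ((eVariationOn γ (Icc 0 b)).toReal - (eVariationOn γ (Icc 0 a)).toReal) = _
  rw [← this, add_sub_cancel_left, ENNReal.ofReal_toReal (hfin _)]

variable [MeasurableSpace X]

/-- `ρ` is `lam`-admissible for the family `Γ`: it is a Borel function `X → [0,∞]` with
`lam (ρ(γ_0) + ρ(γ_1)) + ∫_γ ρ ds ≥ 1` for all `γ ∈ Γ`. Here `0 * ∞ = 0`. -/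
def Admissible (lam : ℝ≥0∞) (Γ : Set C(I, X)) (ρ : X → ℝ≥0∞) : Prop :=
  Measurable ρ ∧ ∀ γ ∈ Γ, 1 ≤ lam * (ρ (γ 0) + ρ (γ 1)) + pathIntegral ρ γ

/-- The `(p, lam)`-modulus of a family of curves. -/
def modulus (m : Measure X) (p : ℝ) (lam : ℝ≥0∞) (Γ : Set C(I, X)) : ℝ≥0∞ :=
  ⨅ (ρ : X → ℝ≥0∞) (_ : Admissible lam Γ ρ), ∫⁻ x, ρ x ^ p ∂m

/-- A plan: a finite Borel measure on the space of curves, concentrated on rectifiable curves. -/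
structure IsPlan (π : Measure C(I, X)) : Prop where
  finite : IsFiniteMeasure π
  concentrated : π {γ | ¬ IsRectifiable γ} = 0

/-- The measure `lam (e_0)_# π + lam (e_1)_# π + ∫ γ_# s_γ dπ(γ)` on `X`. -/
def planMeasure (lam : ℝ≥0∞) (π : Measure C(I, X)) : Measure X :=
  lam • π.map (fun γ => γ 0) + lam • π.map (fun γ => γ 1) +
    π.bind (fun γ => (variationMeasure γ).map γ)

/-- The `lam`-barycenter of a plan, as a density with respect to `m`. -/
def barycenter (m : Measure X) (lam : ℝ≥0∞) (π : Measure C(I, X)) : X → ℝ≥0∞ :=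
  (planMeasure lam π).rnDeriv m

/-- `π` is a plan that admits a `lam`-barycenter in `L^q(m)`. -/
structure HasBarycenter (m : Measure X) (q lam : ℝ≥0∞) (π : Measure C(I, X)) : Prop where
  isPlan : IsPlan π
  absolutelyContinuous : planMeasure lam π ≪ m
  memLp : MemLp (barycenter m lam π) q m

end CurveModulus

end

/-! The theorem is a minimax duality. Put `C = Mod^(-1/p)` and let `energy lam ρ γ` be the left side
of the admissibility condition. If `‖ρ‖_p ≤ 1`, the energy of `ρ` cannot be bounded below on `Γ` by
a constant `a > C`: otherwise `ρ / a` would be admissible, and the modulus would be at most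
`a^(-p)`. On the compact space `Γ`, the continuous functions lying below such energies form a convex
set, disjoint from the open convex set of functions exceeding `C` everywhere. Hahn-Banach separates
the two sets, and Riesz-Markov-Kakutani turns the separating functional into a probability `π` on
`Γ` (`exists_probabilityMeasure_forall_integral_le`). The energy itself may be discontinuous in `γ`,
but it is the limit of continuous lower sums (`tendsto_lowerSum`), so Fatou gives `∫ energy ρ dπ ≤ C
‖ρ‖_p` for bounded continuous `ρ`.

The left side is `∫ ρ dP`, where `P` is the plan measure (`lintegral_planMeasure_map`). Density of
bounded continuous functions and `L^p`-`L^q` duality then give `P ≪ m` with density of `L^q` norm at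
most `C`. Conversely, integrating the admissibility of any `ρ` against `π` and applying Hölder gives
`1 ≤ ‖ρ‖_p ‖Bar‖_q`, hence `‖Bar‖_q ≥ C`. -/

open Filter
open scoped NNReal BoundedContinuousFunction

noncomputable section
namespace CurveModulus

/-! ### Path integrals as limits of continuous lower sums. -/

section

/-- The point `k / n` of the uniform partition of `[0,1]`, truncated at `1`. -/
def gridPoint (n k : ℕ) : I := projIcc 0 1 zero_le_one ((k : ℝ) / n)

theorem gridPoint_mono (n : ℕ) : Monotone (gridPoint n) := fun a b h =>
  monotone_projIcc _ (by gcongr)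

@[simp] theorem gridPoint_zero (n : ℕ) : gridPoint n 0 = 0 := by
  simp [gridPoint]

theorem gridPoint_self {n : ℕ} (hn : n ≠ 0) : gridPoint n n = 1 := by
  have : (n : ℝ) ≠ 0 := by exact_mod_cast hn
  simp [gridPoint, div_self this]

theorem dist_gridPoint_floor_le {n : ℕ} (hn : n ≠ 0) (t : I) :
    dist (gridPoint n ⌊(n : ℝ) * t⌋₊) t ≤ 1 / n := by
  have hn' : (0 : ℝ) < n := by positivity
  have ht : (t : I) = projIcc 0 1 zero_le_one (t : ℝ) := (projIcc_val _ t).symm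
  have h1 := Nat.floor_le (mul_nonneg hn'.le t.2.1)
  have h2 := Nat.lt_floor_add_one ((n : ℝ) * t)
  have h3 : |(⌊(n : ℝ) * t⌋₊ : ℝ) / n - t| ≤ 1 / n := by
    rw [abs_le]
    constructor
    · rw [neg_le_sub_iff_le_add, ← add_div, le_div_iff₀ hn']; linarith
    · rw [sub_le_iff_le_add, div_le_iff₀ hn', add_mul, one_div_mul_cancel hn'.ne']; linarith
  conv_lhs => rw [ht]
  refine le_trans ?_ h3
  rw [projIcc_val]
  have := abs_projIcc_sub_projIcc (zero_le_one' ℝ) (c := (⌊(n : ℝ) * t⌋₊ : ℝ) / n) (d := t)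
  rw [projIcc_val] at this
  exact this

theorem dist_gridPoint_succ_le {n : ℕ} (k : ℕ) :
    dist (gridPoint n k) (gridPoint n (k + 1)) ≤ 1 / n := by
  refine le_trans (abs_projIcc_sub_projIcc (zero_le_one' ℝ)) ?_
  rw [← sub_div, abs_div]
  simp

variable {X : Type*} [MetricSpace X]

/-- The length of the polygon inscribed in `γ` at the points of the uniform partition. -/
def polygonLength (n : ℕ) (γ : C(I, X)) : ℝ≥0∞ :=
  ∑ k ∈ Finset.range n, edist (γ (gridPoint n k)) (γ (gridPoint n (k + 1)))

theorem polygonLength_le_length (n : ℕ) (γ : C(I, X)) : polygonLength n γ ≤ length γ := by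
  unfold polygonLength length
  simp_rw [fun k => edist_comm (γ (gridPoint n k)) (γ (gridPoint n (k + 1)))]
  exact eVariationOn.sum_le (gridPoint_mono n) (fun i => mem_univ _)

/-- The curves that jump along the uniform partition converge pointwise to `γ` and have variation at
most the polygon length. Lower semicontinuity of the variation does the rest. -/
theorem tendsto_polygonLength (γ : C(I, X)) :
    Tendsto (fun n => polygonLength n γ) atTop (𝓝 (length γ)) := by
  refine tendsto_order.2 ⟨fun v hv => ?_, fun v hv =>
    Eventually.of_forall fun n => (polygonLength_le_length n γ).trans_lt hv⟩
  have hlim : ∀ t ∈ (univ : Set I),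
      Tendsto (fun n : ℕ => (γ ∘ fun s : I => gridPoint n ⌊(n : ℝ) * s⌋₊) t) atTop (𝓝 (γ t)) := by
    intro t _
    refine (γ.continuous.tendsto t).comp ?_
    rw [tendsto_iff_dist_tendsto_zero]
    refine squeeze_zero' (Eventually.of_forall fun _ => dist_nonneg) ?_
      tendsto_one_div_atTop_nhds_zero_nat
    filter_upwards [eventually_ne_atTop 0] with n hn using dist_gridPoint_floor_le hn t
  filter_upwards [eVariationOn.lowerSemicontinuous_aux hlim hv] with n hn
  refine hn.trans_le ?_
  rw [polygonLength, ← eVariationOn.image_range_of_monotone γ (gridPoint_mono n)]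
  refine eVariationOn.comp_le_of_monotoneOn γ _ (fun s _ t _ hst => ?_) fun s _ => ?_
  · refine gridPoint_mono n (Nat.floor_mono ?_)
    have : (s : ℝ) ≤ t := hst
    gcongr
  · refine mem_image_of_mem _ (mem_Iic.2 (Nat.floor_le_of_le ?_))
    exact mul_le_of_le_one_right (Nat.cast_nonneg n) s.2.2

theorem isFiniteMeasure_variationMeasure (γ : C(I, X)) : IsFiniteMeasure (variationMeasure γ) := by
  by_cases hγ : IsRectifiable γ
  · constructor
    have := variationMeasure_Icc γ hγ (zero_le_one' I)
    rw [← Icc_bot_top]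
    change variationMeasure γ (Icc 0 1) < ∞
    rw [this]
    exact lt_of_le_of_lt (eVariationOn.mono γ (subset_univ _)) hγ.lt_top
  · rw [variationMeasure, dif_neg hγ]; infer_instance

theorem nullSingletonClass_variationMeasure {γ : C(I, X)} (hγ : IsRectifiable γ) :
    NullSingletonClass (variationMeasure γ) := by
  constructor
  intro a
  rw [← Icc_self, variationMeasure_Icc γ hγ le_rfl]
  exact eVariationOn.subsingleton _ (by simp)

theorem lintegral_Ioc_monotone_sum {μ : Measure I} (f : I → ℝ≥0∞) {t : ℕ → I} (ht : Monotone t)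
    (n : ℕ) : ∫⁻ x in Ioc (t 0) (t n), f x ∂μ =
      ∑ k ∈ Finset.range n, ∫⁻ x in Ioc (t k) (t (k + 1)), f x ∂μ := by
  induction n with
  | zero => simp
  | succ n ih =>
    rw [Finset.sum_range_succ, ← ih, ← lintegral_union measurableSet_Ioc,
      Ioc_union_Ioc_eq_Ioc (ht (Nat.zero_le n)) (ht (Nat.le_succ n))]
    exact Ioc_disjoint_Ioc_of_le le_rfl

theorem lintegral_variationMeasure_eq_sum {γ : C(I, X)} (hγ : IsRectifiable γ) (f : I → ℝ≥0∞)
    {n : ℕ} (hn : n ≠ 0) : ∫⁻ x, f x ∂(variationMeasure γ) = ∑ k ∈ Finset.range n,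
      ∫⁻ x in Ioc (gridPoint n k) (gridPoint n (k + 1)), f x ∂(variationMeasure γ) := by
  have := nullSingletonClass_variationMeasure hγ
  rw [← lintegral_Ioc_monotone_sum f (gridPoint_mono n), gridPoint_zero, gridPoint_self hn,
    Measure.restrict_congr_set Ioc_ae_eq_Icc]
  change _ = ∫⁻ x in Icc ⊥ ⊤, _ ∂_
  rw [Icc_bot_top, Measure.restrict_univ]

/-- A lower Riemann sum for `∫_γ ρ ds`, depending continuously on `γ`. -/
def lowerSum (n : ℕ) (ρ : X → ℝ≥0) (γ : C(I, X)) : ℝ≥0 :=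
  ∑ k ∈ Finset.range n, sInf ((fun t => ρ (γ t)) '' Icc (gridPoint n k) (gridPoint n (k + 1))) *
    nndist (γ (gridPoint n k)) (γ (gridPoint n (k + 1)))

/-- Chords are used in place of arc lengths because length is only lower semicontinuous in `γ`. The
infimum of a jointly continuous function over a compact interval is continuous in the parameter. -/
theorem continuous_lowerSum (n : ℕ) {ρ : X → ℝ≥0} (hρ : Continuous ρ) :
    Continuous (lowerSum n ρ : C(I, X) → ℝ≥0) := by
  refine continuous_finsetSum _ fun k _ => ?_
  refine Continuous.mul ?_ (by fun_prop)
  refine isCompact_Icc.continuous_sInf (f := fun (γ : C(I, X)) t => ρ (γ t)) ?_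
  exact hρ.comp (by fun_prop)

theorem edist_le_variationMeasure {γ : C(I, X)} (hγ : IsRectifiable γ) {a b : I} (hab : a ≤ b) :
    edist (γ a) (γ b) ≤ variationMeasure γ (Ioc a b) := by
  have := nullSingletonClass_variationMeasure hγ
  rw [measure_congr Ioc_ae_eq_Icc, variationMeasure_Icc γ hγ hab]
  exact eVariationOn.edist_le γ (left_mem_Icc.2 hab) (right_mem_Icc.2 hab)

theorem lowerSum_le_pathIntegral {γ : C(I, X)} (hγ : IsRectifiable γ) (n : ℕ) (ρ : X → ℝ≥0) :
    (lowerSum n ρ γ : ℝ≥0∞) ≤ pathIntegral (fun x => ρ x) γ := by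
  rcases eq_or_ne n 0 with rfl | hn
  · simp [lowerSum]
  rw [pathIntegral, if_pos hγ, lintegral_variationMeasure_eq_sum hγ _ hn, lowerSum,
    ENNReal.ofNNReal_finsetSum]
  refine Finset.sum_le_sum fun k _ => ?_
  have hk := gridPoint_mono n (Nat.le_succ k)
  rw [ENNReal.coe_mul, ← edist_nndist]
  refine (mul_le_mul_right (edist_le_variationMeasure hγ hk) _).trans ?_
  rw [← setLIntegral_const]
  refine setLIntegral_mono' measurableSet_Ioc fun t ht => ?_
  exact_mod_cast csInf_le (OrderBot.bddBelow _) (mem_image_of_mem _ (Ioc_subset_Icc_self ht))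

/-- A subtraction-free form of the error bound `∫_γ ρ ds - lowerSum ≤ ε ℓ(γ) + M (ℓ(γ) -
polygonLength)`: oscillation of `ρ` on a piece, plus excess of arc over chord. -/
theorem pathIntegral_add_le_lowerSum_add {γ : C(I, X)} (hγ : IsRectifiable γ) {ρ : X → ℝ≥0}
    (hρ : Continuous ρ) {M ε : ℝ≥0} (hM : ∀ x, ρ x ≤ M) {n : ℕ} (hn : n ≠ 0)
    (hε : ∀ s t : I, dist s t ≤ 1 / n → ρ (γ s) ≤ ρ (γ t) + ε) :
    pathIntegral (fun x => ρ x) γ + M * polygonLength n γ ≤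
      lowerSum n ρ γ + (ε * length γ + M * length γ) := by
  have hlen : length γ = ∫⁻ _, 1 ∂(variationMeasure γ) := by
    rw [lintegral_one, ← Icc_bot_top]
    change _ = variationMeasure γ (Icc 0 1)
    rw [variationMeasure_Icc γ hγ zero_le_one, length, ← Icc_bot_top]; rfl
  rw [hlen, lintegral_variationMeasure_eq_sum hγ _ hn, pathIntegral, if_pos hγ,
    lintegral_variationMeasure_eq_sum hγ _ hn, lowerSum, ENNReal.ofNNReal_finsetSum,
    polygonLength, Finset.mul_sum, Finset.mul_sum, Finset.mul_sum,
    ← Finset.sum_add_distrib, ← Finset.sum_add_distrib, ← Finset.sum_add_distrib]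
  refine Finset.sum_le_sum fun k _ => ?_
  have hk := gridPoint_mono n (Nat.le_succ k)
  have hc : Continuous fun t => ρ (γ t) := hρ.comp γ.continuous
  obtain ⟨s, hs, hsm⟩ := isCompact_Icc.exists_sInf_image_eq (nonempty_Icc.2 hk) hc.continuousOn
  rw [hsm]
  have hd := edist_le_variationMeasure hγ hk
  have hint : ∫⁻ t in Ioc (gridPoint n k) (gridPoint n (k + 1)), ρ (γ t) ∂(variationMeasure γ) ≤
      (ρ (γ s) + ε : ℝ≥0) * variationMeasure γ (Ioc (gridPoint n k) (gridPoint n (k + 1))) := by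
    rw [← setLIntegral_const]
    refine setLIntegral_mono' measurableSet_Ioc fun t ht => ?_
    refine ENNReal.coe_le_coe.2 (hε t s (le_trans ?_ (dist_gridPoint_succ_le (n := n) k)))
    have h1 := Ioc_subset_Icc_self ht
    rw [dist_comm (gridPoint n k)]
    exact (Real.dist_le_of_mem_Icc (x := t) (y := s) h1 hs).trans (le_abs_self _)
  rw [lintegral_one, Measure.restrict_apply_univ, ENNReal.coe_mul, ← edist_nndist]
  -- `e` is the excess of arc length over chord on this piece.
  obtain ⟨e, he⟩ := exists_add_of_le hd
  calc _ ≤ _ + _ := add_le_add_left hint _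
    _ = (ρ (γ s) : ℝ≥0∞) * edist (γ (gridPoint n k)) (γ (gridPoint n (k + 1))) + (ε *
        variationMeasure γ (Ioc (gridPoint n k) (gridPoint n (k + 1))) +
        (M * edist (γ (gridPoint n k)) (γ (gridPoint n (k + 1))) + ρ (γ s) * e)) := by
      rw [ENNReal.coe_add, he]; ring
    _ ≤ _ := by
      rw [he, mul_add (M : ℝ≥0∞)]
      gcongr
      exact hM _

theorem tendsto_lowerSum {γ : C(I, X)} (hγ : IsRectifiable γ) (ρ : X →ᵇ ℝ≥0) :
    Tendsto (fun n => (lowerSum n ρ γ : ℝ≥0∞)) atTop (𝓝 (pathIntegral (fun x => ρ x) γ)) := by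
  refine tendsto_order.2 ⟨fun v hv => ?_, fun v hv =>
    Eventually.of_forall fun n => (lowerSum_le_pathIntegral hγ n ρ).trans_lt hv⟩
  have hM : ∀ x, ρ x ≤ nndist ρ 0 := fun x => by
    simpa [NNReal.nndist_eq] using BoundedContinuousFunction.nndist_coe_le_nndist (f := ρ) (g := 0) x
  set M := nndist ρ 0
  obtain ⟨ε, hε0, hε⟩ := ENNReal.exists_nnreal_pos_mul_lt (a := length γ) hγ (tsub_pos_of_lt hv).ne'
  have huc : UniformContinuous fun t => ρ (γ t) :=
    CompactSpace.uniformContinuous_of_continuous (ρ.continuous.comp γ.continuous)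
  obtain ⟨δ, hδ, hδε⟩ := Metric.uniformContinuous_iff.1 huc ε (by exact_mod_cast hε0)
  have hfin : (ε * length γ + M * length γ : ℝ≥0∞) ≠ ∞ :=
    ENNReal.add_ne_top.2 ⟨ENNReal.mul_ne_top ENNReal.coe_ne_top hγ,
      ENNReal.mul_ne_top ENNReal.coe_ne_top hγ⟩
  have hlim : Tendsto (fun n => pathIntegral (fun x => ρ x) γ + M * polygonLength n γ) atTop
      (𝓝 (pathIntegral (fun x => ρ x) γ + M * length γ)) :=
    tendsto_const_nhds.add
      (ENNReal.Tendsto.const_mul (tendsto_polygonLength γ) (Or.inr ENNReal.coe_ne_top))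
  have hlt : v + (ε * length γ + M * length γ) < pathIntegral (fun x => ρ x) γ + M * length γ := by
    rw [← add_assoc]
    refine ENNReal.add_lt_add_right (ENNReal.mul_ne_top ENNReal.coe_ne_top hγ) ?_
    rw [add_comm]
    exact lt_tsub_iff_right.1 hε
  filter_upwards [hlim.eventually_const_lt hlt, eventually_ne_atTop 0,
    tendsto_one_div_atTop_nhds_zero_nat.eventually_lt_const hδ] with n h1 hn h2
  refine (ENNReal.add_lt_add_iff_right hfin).1 (h1.trans_le
    (pathIntegral_add_le_lowerSum_add hγ ρ.continuous hM hn fun s t hst => ?_))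
  have h3 := hδε (hst.trans_lt h2)
  rw [NNReal.dist_eq] at h3
  have h4 := (abs_lt.1 h3).2
  exact_mod_cast (sub_lt_iff_lt_add'.1 h4).le

variable [MeasurableSpace X] [BorelSpace X]

theorem lintegral_map_variationMeasure {γ : C(I, X)} (hγ : IsRectifiable γ) {ρ : X → ℝ≥0∞}
    (hρ : Measurable ρ) : ∫⁻ x, ρ x ∂((variationMeasure γ).map γ) = pathIntegral ρ γ := by
  rw [pathIntegral, if_pos hγ, lintegral_map hρ γ.continuous.measurable]

/-- Integrals of bounded continuous functions are limits of lower sums, hence measurable in `γ`.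
Closed sets follow by outer approximation, and they form a generating π-system. -/
theorem measurable_map_variationMeasure {Γ : Set C(I, X)} (hΓ : ∀ γ ∈ Γ, IsRectifiable γ) :
    Measurable fun γ : Γ => (variationMeasure (γ : C(I, X))).map (γ : C(I, X)) := by
  have hfin (γ : Γ) : IsFiniteMeasure ((variationMeasure (γ : C(I, X))).map (γ : C(I, X))) :=
    have := isFiniteMeasure_variationMeasure (γ : C(I, X))
    Measure.isFiniteMeasure_map _ _
  have hcont (ρ : X →ᵇ ℝ≥0) : Measurable fun γ : Γ =>
      ∫⁻ x, ρ x ∂((variationMeasure (γ : C(I, X))).map (γ : C(I, X))) := by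
    have hm (γ : Γ) := lintegral_map_variationMeasure (hΓ γ γ.2)
      (ρ := fun x => (ρ x : ℝ≥0∞)) (by fun_prop)
    simp_rw [hm]
    refine ENNReal.measurable_of_tendsto (f := fun n (γ : Γ) => (lowerSum n ρ (γ : C(I, X)) : ℝ≥0∞))
      (fun n => ?_) (tendsto_pi_nhds.2 fun γ => tendsto_lowerSum (hΓ γ γ.2) ρ)
    exact (ENNReal.continuous_coe.comp
      ((continuous_lowerSum n ρ.continuous).comp continuous_subtype_val)).measurable
  refine Measurable.measure_of_isPiSystem
    (BorelSpace.measurable_eq.trans borel_eq_generateFrom_isClosed) isPiSystem_isClosed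
    (fun F hF => ?_) ?_
  · exact ENNReal.measurable_of_tendsto (fun n => hcont (IsClosed.apprSeq hF n))
      (tendsto_pi_nhds.2 fun γ => HasOuterApproxClosed.tendsto_lintegral_apprSeq hF _)
  · simpa using hcont 1

end

/-! ### Separation on `Γ` and the minimax plan. -/

section
theorem lintegral_const_mul_rpow_rpow {X : Type*} [MeasurableSpace X] (m : Measure X) {p : ℝ} (hp : 0 < p) (f : X → ℝ≥0∞)
    {a : ℝ≥0∞} (ha : a ≠ ∞) :
    (∫⁻ x, (a * f x) ^ p ∂m) ^ (1 / p) = a * (∫⁻ x, f x ^ p ∂m) ^ (1 / p) := by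
  simp_rw [ENNReal.mul_rpow_of_nonneg _ _ hp.le]
  rw [lintegral_const_mul' _ _ (ENNReal.rpow_ne_top_of_nonneg hp.le ha),
    ENNReal.mul_rpow_of_nonneg _ _ (by positivity), ← ENNReal.rpow_mul, mul_one_div_cancel hp.ne',
    ENNReal.rpow_one]

section Riesz

/-- Riesz-Markov-Kakutani for a linear functional on `C(K, ℝ)` normalised at `1`. -/
theorem exists_probabilityMeasure_integral_eq {K : Type*} [TopologicalSpace K] [T2Space K]
    [CompactSpace K] [MeasurableSpace K] [BorelSpace K] (Λ : C(K, ℝ) →ₗ[ℝ] ℝ)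
    (hnn : ∀ f : C(K, ℝ), 0 ≤ f → 0 ≤ Λ f) (h1 : Λ 1 = 1) :
    ∃ μ : Measure K, IsProbabilityMeasure μ ∧ ∀ f : C(K, ℝ), ∫ x, f x ∂μ = Λ f := by
  let T : CompactlySupportedContinuousMap K ℝ →ₚ[ℝ] ℝ := PositiveLinearMap.mk₀
    { toFun := fun f => Λ f.toContinuousMap
      map_add' := fun f g => Λ.map_add f.toContinuousMap g.toContinuousMap
      map_smul' := fun a f => Λ.map_smul a f.toContinuousMap }
    fun f hf => hnn _ hf
  have hint : ∀ f : C(K, ℝ), ∫ x, f x ∂(RealRMK.rieszMeasure T) = Λ f := fun f =>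
    RealRMK.integral_rieszMeasure T (CompactlySupportedContinuousMap.continuousMapEquiv f)
  refine ⟨RealRMK.rieszMeasure T, ⟨?_⟩, hint⟩
  have := (hint 1).trans h1
  simp only [ContinuousMap.one_apply, integral_const, smul_eq_mul, mul_one] at this
  exact (ENNReal.toReal_eq_one_iff _).1 this

/-- If a convex set `A ∋ 0` of continuous functions on a compact space contains no function that
exceeds `c` everywhere, then some probability measure has integral at most `c` on all of `A`. -/
theorem exists_probabilityMeasure_forall_integral_le {K : Type*} [TopologicalSpace K] [T2Space K]
    [CompactSpace K] [MeasurableSpace K] [BorelSpace K] {A : Set C(K, ℝ)} (hA : Convex ℝ A)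
    (h0 : 0 ∈ A) {c : ℝ} (hc : 0 ≤ c) (hAc : ∀ f ∈ A, ∃ x, f x ≤ c) :
    ∃ μ : Measure K, IsProbabilityMeasure μ ∧ ∀ f ∈ A, ∫ x, f x ∂μ ≤ c := by
  let B : Set C(K, ℝ) := {f | ∀ x, c < f x}
  have hBo : IsOpen B := by
    have := ContinuousMap.isOpen_setOfPred_mapsTo (X := K) (Y := ℝ) isCompact_univ (isOpen_Ioi (a := c))
    simpa [MapsTo, B] using this
  have hBc : Convex ℝ B := by
    intro f hf g hg a b ha hb hab x
    have := (convex_Ioi c) (hf x) (hg x) ha hb hab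
    simpa using this
  have hdisj : Disjoint B A := by
    rw [Set.disjoint_left]
    intro f hfB hfA
    obtain ⟨x, hx⟩ := hAc f hfA
    exact absurd (hfB x) hx.not_gt
  obtain ⟨f, u, hfB, hfA⟩ := geometric_hahn_banach_open hBc hBo hA hdisj
  have hu : u ≤ 0 := by simpa using hfA 0 h0
  -- `B` is stable under adding nonnegative functions, which forces `f` to be nonpositive on them.
  -- The constants `t` decreasing to `c` give `c * f 1 ≤ u`.
  have hone (t : ℝ) (ht : c < t) (g : C(K, ℝ)) (hg : 0 ≤ g) : t * f 1 + f g < u := by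
    have : t • (1 : C(K, ℝ)) + g ∈ B := fun x => by
      have : 0 ≤ g x := hg x
      simp; linarith
    simpa using hfB _ this
  have hf1 : f 1 < 0 := by
    have := hone (c + 1) (by linarith) 0 le_rfl
    simp only [map_zero, add_zero] at this
    by_contra! h
    nlinarith
  have hfnn (g : C(K, ℝ)) (hg : 0 ≤ g) : f g ≤ 0 := by
    by_contra! h
    have hr : 0 ≤ (c + 1) * (-f 1) / f g := by
      have := neg_pos.2 hf1
      positivity
    have := hone (c + 1) (by linarith) (((c + 1) * (-f 1) / f g) • g) (smul_nonneg hr hg)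
    rw [map_smul, smul_eq_mul, div_mul_cancel₀ _ h.ne'] at this
    linarith
  have hcu : c * f 1 ≤ u := by
    refine le_of_forall_pos_le_add fun ε hε => ?_
    have := hone (c + ε / (-f 1)) (by have := div_pos hε (neg_pos.2 hf1); linarith) 0 le_rfl
    rw [map_zero, add_zero, add_mul, div_mul_eq_mul_div, mul_div_assoc,
      div_neg, div_self hf1.ne] at this
    linarith
  -- Dividing by `f 1 < 0` makes the functional positive and normalised.
  obtain ⟨μ, hμ, hint⟩ := exists_probabilityMeasure_integral_eq (K := K)
    ((f 1)⁻¹ • (f : C(K, ℝ) →ₗ[ℝ] ℝ))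
    (fun g hg => mul_nonneg_of_nonpos_of_nonpos (inv_nonpos.2 hf1.le) (hfnn g hg))
    (inv_mul_cancel₀ hf1.ne)
  refine ⟨μ, hμ, fun g hg => ?_⟩
  rw [hint]
  change (f 1)⁻¹ * f g ≤ c
  have := hfA g hg
  calc (f 1)⁻¹ * f g ≤ (f 1)⁻¹ * (c * f 1) :=
        mul_le_mul_of_nonpos_left (hcu.trans this) (inv_nonpos.2 hf1.le)
    _ = c := by rw [mul_comm, mul_inv_cancel_right₀ hf1.ne]
end Riesz

variable {X : Type*} [MetricSpace X]

/-- The functional `lam (ρ(γ_0) + ρ(γ_1)) + ∫_γ ρ ds` of the admissibility condition. -/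
def energy (lam : ℝ≥0∞) (ρ : X → ℝ≥0∞) (γ : C(I, X)) : ℝ≥0∞ :=
  lam * (ρ (γ 0) + ρ (γ 1)) + pathIntegral ρ γ

theorem energy_const_mul {lam : ℝ≥0∞} {ρ : X → ℝ≥0∞} {γ : C(I, X)}
    (hγ : IsRectifiable γ) {a : ℝ≥0∞} (ha : a ≠ ∞) :
    energy lam (fun x => a * ρ x) γ = a * energy lam ρ γ := by
  rw [energy, energy, pathIntegral, pathIntegral, if_pos hγ, if_pos hγ, lintegral_const_mul' _ _ ha]
  ring

theorem energy_add {lam : ℝ≥0∞} {ρ ρ' : X → ℝ≥0} (hρ : Continuous ρ) {γ : C(I, X)}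
    (hγ : IsRectifiable γ) :
    energy lam (fun x => ρ x + ρ' x) γ =
      energy lam (fun x => ρ x) γ + energy lam (fun x => ρ' x) γ := by
  simp only [energy, pathIntegral, if_pos hγ]
  have hm : Measurable fun t : I => (ρ (γ t) : ℝ≥0∞) :=
    (ENNReal.continuous_coe.comp (hρ.comp γ.continuous)).measurable
  rw [lintegral_add_left hm]
  ring

variable [MeasurableSpace X]

theorem nonempty_of_modulus_pos {m : Measure X} {p : ℝ} (hp : 0 < p) {lam : ℝ≥0∞}
    {Γ : Set C(I, X)} (hpos : 0 < modulus m p lam Γ) : Γ.Nonempty := by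
  by_contra h
  rw [not_nonempty_iff_eq_empty] at h
  refine hpos.not_ge ((iInf₂_le (fun _ => 0) ⟨measurable_const, by simp [h]⟩).trans ?_)
  simp [hp]

/-- The modulus bounds the energy of a function of norm at most `1` somewhere on `Γ`. -/
theorem le_modulus_rpow_of_le_energy {m : Measure X} {p : ℝ} (hp : 1 ≤ p) {lam : ℝ≥0∞}
    {Γ : Set C(I, X)} (hΓ : ∀ γ ∈ Γ, IsRectifiable γ) {ρ : X → ℝ≥0∞} (hρ : Measurable ρ)
    (hnorm : (∫⁻ x, ρ x ^ p ∂m) ^ (1 / p) ≤ 1) {a : ℝ≥0∞} (ha : a ≠ 0) (ha' : a ≠ ∞)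
    (h : ∀ γ ∈ Γ, a ≤ energy lam ρ γ) : a ≤ modulus m p lam Γ ^ (-(1 / p)) := by
  have hp0 : 0 < p := by linarith
  have hadm : Admissible lam Γ fun x => a⁻¹ * ρ x := by
    refine ⟨hρ.const_mul _, fun γ hγ => ?_⟩
    change 1 ≤ energy lam (fun x => a⁻¹ * ρ x) γ
    rw [energy_const_mul (hΓ γ hγ) (ENNReal.inv_ne_top.2 ha), ← ENNReal.inv_mul_cancel ha ha']
    gcongr
    exact h γ hγ
  have h1 : modulus m p lam Γ ^ (1 / p) ≤ a⁻¹ := by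
    calc _ ≤ (∫⁻ x, (a⁻¹ * ρ x) ^ p ∂m) ^ (1 / p) := by
          gcongr; exact iInf₂_le _ hadm
      _ ≤ a⁻¹ * 1 := by
          rw [lintegral_const_mul_rpow_rpow m hp0 _ (ENNReal.inv_ne_top.2 ha)]; gcongr
      _ = a⁻¹ := mul_one _
  rw [ENNReal.rpow_neg]
  exact ENNReal.le_inv_iff_le_inv.2 h1

variable [BorelSpace X]

theorem exists_probabilityMeasure_lintegral_energy_le {m : Measure X} {p : ℝ} (hp : 1 ≤ p)
    (lam : ℝ≥0) {Γ : Set C(I, X)} (hΓ : IsCompact Γ) (hrect : ∀ γ ∈ Γ, IsRectifiable γ)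
    (hpos : 0 < modulus m p lam Γ) (hfin : modulus m p lam Γ < ∞) :
    ∃ π : Measure Γ, IsProbabilityMeasure π ∧ ∀ ρ : X →ᵇ ℝ≥0,
      ∫⁻ γ, energy lam (fun x => ρ x) (γ : C(I, X)) ∂π ≤
        modulus m p lam Γ ^ (-(1 / p)) * (∫⁻ x, (ρ x : ℝ≥0∞) ^ p ∂m) ^ (1 / p) := by
  have hp0 : 0 < p := by linarith
  have : CompactSpace Γ := isCompact_iff_compactSpace.1 hΓ
  have : Nonempty Γ := (nonempty_of_modulus_pos hp0 hpos).to_subtype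
  set C := modulus m p lam Γ ^ (-(1 / p)) with hC
  have hCtop : C ≠ ∞ := by
    rw [hC, ENNReal.rpow_neg]
    exact ENNReal.inv_ne_top.2 (ENNReal.rpow_pos hpos hfin.ne).ne'
  have hC0 : C ≠ 0 := by
    rw [hC, ENNReal.rpow_neg]
    exact ENNReal.inv_ne_zero.2 (ENNReal.rpow_ne_top_of_nonneg (by positivity) hfin.ne)
  -- Continuous minorants replace the energies, which need not be continuous on `Γ`.
  let A : Set C(Γ, ℝ) := {φ | ∃ ρ : X →ᵇ ℝ≥0, (∫⁻ x, (ρ x : ℝ≥0∞) ^ p ∂m) ^ (1 / p) ≤ 1 ∧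
    ∀ γ : Γ, ENNReal.ofReal (φ γ) ≤ energy lam (fun x => ρ x) (γ : C(I, X))}
  have hA : Convex ℝ A := by
    rintro φ ⟨ρ, hρ, hφ⟩ ψ ⟨τ, hτ, hψ⟩ a b ha hb hab
    lift a to ℝ≥0 using ha
    lift b to ℝ≥0 using hb
    have hab' : (a : ℝ≥0∞) + b = 1 := by exact_mod_cast hab
    refine ⟨a • ρ + b • τ, ?_, fun γ => ?_⟩
    · calc _ ≤ (∫⁻ x, (a * ρ x : ℝ≥0∞) ^ p ∂m) ^ (1 / p) +
            (∫⁻ x, (b * τ x : ℝ≥0∞) ^ p ∂m) ^ (1 / p) := by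
            have := ENNReal.lintegral_Lp_add_le (μ := m) (f := fun x => (a * ρ x : ℝ≥0∞))
              (g := fun x => (b * τ x : ℝ≥0∞)) (by fun_prop) (by fun_prop) hp
            simpa using this
        _ ≤ a * 1 + b * 1 := by
            rw [lintegral_const_mul_rpow_rpow m hp0 _ ENNReal.coe_ne_top,
              lintegral_const_mul_rpow_rpow m hp0 _ ENNReal.coe_ne_top]
            gcongr
        _ = 1 := by simpa using hab'
    · have hγ := hrect γ γ.2
      have hsum := energy_add (lam := lam) (ρ := fun x => a * ρ x) (ρ' := fun x => b * τ x)
        (by fun_prop) hγ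
      simp only [ENNReal.coe_mul] at hsum
      rw [energy_const_mul hγ ENNReal.coe_ne_top, energy_const_mul hγ ENNReal.coe_ne_top] at hsum
      simp only [BoundedContinuousFunction.coe_add, BoundedContinuousFunction.coe_smul,
        Pi.add_apply, smul_eq_mul, ENNReal.coe_add, ENNReal.coe_mul, ContinuousMap.add_apply,
        ContinuousMap.smul_apply]
      rw [hsum]
      refine ENNReal.ofReal_add_le.trans ?_
      rw [ENNReal.ofReal_mul a.coe_nonneg, ENNReal.ofReal_mul b.coe_nonneg, ENNReal.ofReal_coe_nnreal,
        ENNReal.ofReal_coe_nnreal]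
      gcongr
      exacts [hφ γ, hψ γ]
  have hA0 : (0 : C(Γ, ℝ)) ∈ A := ⟨0, by simp [hp0], by simp⟩
  have hAc : ∀ φ ∈ A, ∃ γ, φ γ ≤ C.toReal := by
    rintro φ ⟨ρ, hρ, hφ⟩
    by_contra! hcon
    -- The minimum over the compact `Γ` turns the pointwise strict inequality into a single constant
    -- above `C`.
    obtain ⟨γ₀, -, hγ₀⟩ := isCompact_univ.exists_isMinOn univ_nonempty φ.continuous.continuousOn
    have hφ0 : 0 < φ γ₀ := ENNReal.toReal_nonneg.trans_lt (hcon γ₀)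
    refine (le_modulus_rpow_of_le_energy hp hrect (a := ENNReal.ofReal (φ γ₀)) (lam := lam)
      (by fun_prop) hρ (ENNReal.ofReal_pos.2 hφ0).ne' ENNReal.ofReal_ne_top
      fun γ hγ => ?_).not_gt ((ENNReal.lt_ofReal_iff_toReal_lt hCtop).2 (hcon γ₀))
    exact (ENNReal.ofReal_le_ofReal (hγ₀ (mem_univ ⟨γ, hγ⟩))).trans (hφ ⟨γ, hγ⟩)
  obtain ⟨π, hπ, hle⟩ := exists_probabilityMeasure_forall_integral_le hA hA0
    ENNReal.toReal_nonneg hAc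
  refine ⟨π, hπ, ?_⟩
  have hunit (ρ : X →ᵇ ℝ≥0) (hρ : (∫⁻ x, (ρ x : ℝ≥0∞) ^ p ∂m) ^ (1 / p) ≤ 1) :
      ∫⁻ γ, energy lam (fun x => ρ x) (γ : C(I, X)) ∂π ≤ C := by
    let F (n : ℕ) (γ : Γ) : ℝ≥0 :=
      lam * (ρ ((γ : C(I, X)) 0) + ρ ((γ : C(I, X)) 1)) + lowerSum n ρ (γ : C(I, X))
    have hFc (n : ℕ) : Continuous (F n) := by
      have := (continuous_lowerSum n ρ.continuous).comp (continuous_subtype_val (p := (· ∈ Γ)))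
      refine Continuous.add ?_ this
      fun_prop
    have hFlim (γ : Γ) : Tendsto (fun n => (F n γ : ℝ≥0∞)) atTop
        (𝓝 (energy lam (fun x => ρ x) (γ : C(I, X)))) := by
      simp only [F, ENNReal.coe_add, ENNReal.coe_mul]
      exact tendsto_const_nhds.add (tendsto_lowerSum (hrect γ γ.2) ρ)
    have hF (n : ℕ) : ∫⁻ γ, F n γ ∂π ≤ C := by
      have hmem : (⟨fun γ => (F n γ : ℝ), by fun_prop⟩ : C(Γ, ℝ)) ∈ A := by
        refine ⟨ρ, hρ, fun γ => ?_⟩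
        rw [ContinuousMap.coe_mk, ENNReal.ofReal_coe_nnreal, energy]
        simp only [F, ENNReal.coe_add, ENNReal.coe_mul]
        gcongr
        exact lowerSum_le_pathIntegral (hrect γ γ.2) n ρ
      have hint := hle _ hmem
      have hi : Integrable (fun γ => (F n γ : ℝ)) π :=
        (NNReal.continuous_coe.comp (hFc n)).integrable_of_hasCompactSupport
          (HasCompactSupport.of_compactSpace _)
      rw [lintegral_coe_eq_integral _ hi]
      exact ENNReal.ofReal_le_of_le_toReal hint
    calc ∫⁻ γ, energy lam (fun x => ρ x) (γ : C(I, X)) ∂π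
        = ∫⁻ γ, liminf (fun n => (F n γ : ℝ≥0∞)) atTop ∂π :=
          lintegral_congr fun γ => (hFlim γ).liminf_eq.symm
      _ ≤ liminf (fun n => ∫⁻ γ, F n γ ∂π) atTop :=
          lintegral_liminf_le fun n => (ENNReal.continuous_coe.comp (hFc n)).measurable
      _ ≤ C := liminf_le_of_le (by isBoundedDefault) fun b hb => by
          obtain ⟨n, hn⟩ := hb.exists
          exact hn.trans (hF n)
  intro ρ
  rw [mul_comm, ← ENNReal.div_le_iff hC0 hCtop]
  -- The norm of `ρ` may be `0` or `∞`, so `ρ` is normalised by an arbitrary finite `s` above it.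
  refine le_of_forall_gt_imp_ge_of_dense fun s hs => ?_
  rcases eq_or_ne s ∞ with rfl | hs_fin
  · exact le_top
  lift s to ℝ≥0 using hs_fin
  have hs0 : s ≠ 0 := by rintro rfl; simp at hs
  have hs0' : (s : ℝ≥0∞) ≠ 0 := by exact_mod_cast hs0
  have hcoe (x : X) : (((s⁻¹ • ρ) x : ℝ≥0) : ℝ≥0∞) = (s : ℝ≥0∞)⁻¹ * ρ x := by
    simp [ENNReal.coe_inv hs0]
  have h1 := hunit (s⁻¹ • ρ) (by
    simp_rw [hcoe]
    rw [lintegral_const_mul_rpow_rpow m hp0 _ (ENNReal.inv_ne_top.2 hs0'),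
      ← ENNReal.inv_mul_cancel hs0' ENNReal.coe_ne_top]
    gcongr)
  simp_rw [hcoe] at h1
  have h2 (γ : Γ) := energy_const_mul (lam := lam) (ρ := fun x => (ρ x : ℝ≥0∞)) (hrect γ γ.2)
    (ENNReal.inv_ne_top.2 hs0')
  simp_rw [h2] at h1
  rw [lintegral_const_mul' _ _ (ENNReal.inv_ne_top.2 hs0')] at h1
  rw [ENNReal.div_le_iff hC0 hCtop]
  rwa [ENNReal.inv_mul_le_iff hs0' ENNReal.coe_ne_top] at h1

end

/-! ### From bounded continuous test functions to an `L^q` density. -/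

section
section Density

/-- Multiplying `ρ` by a continuous cutoff equal to `1` on `E` does not change its `P`-integral.
This localises the bound to a region where `m` will be finite. -/
theorem lintegral_le_setLIntegral_thickening {Y : Type*} [PseudoMetricSpace Y] [MeasurableSpace Y]
    [BorelSpace Y] {m P : Measure Y} {p : ℝ} (hp : 1 ≤ p) {C : ℝ≥0∞} {E : Set Y} (hE : P Eᶜ = 0)
    (h : ∀ ρ : Y →ᵇ ℝ≥0, ∫⁻ x, ρ x ∂P ≤ C * (∫⁻ x, (ρ x : ℝ≥0∞) ^ p ∂m) ^ (1 / p)) (ρ : Y →ᵇ ℝ≥0) :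
    ∫⁻ x, ρ x ∂P ≤
      C * (∫⁻ x in Metric.thickening 1 E, (ρ x : ℝ≥0∞) ^ p ∂m) ^ (1 / p) := by
  have hp0 : 0 < p := by linarith
  set χ := thickenedIndicator one_pos E
  calc ∫⁻ x, ρ x ∂P = ∫⁻ x, (ρ * χ) x ∂P := by
        refine lintegral_congr_ae ?_
        filter_upwards [measure_eq_zero_iff_ae_notMem.1 hE] with x hx
        simp [χ, thickenedIndicator_one one_pos E (not_not.1 hx)]
    _ ≤ C * (∫⁻ x, ((ρ * χ) x : ℝ≥0∞) ^ p ∂m) ^ (1 / p) := h _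
    _ ≤ _ := by
        refine mul_le_mul_right (ENNReal.rpow_le_rpow ?_ (by positivity)) C
        rw [← lintegral_indicator Metric.isOpen_thickening.measurableSet]
        refine lintegral_mono fun x => ?_
        by_cases hx : x ∈ Metric.thickening 1 E
        · rw [indicator_of_mem hx]
          gcongr
          exact mul_le_of_le_one_right zero_le (thickenedIndicator_le_one one_pos E x)
        · simp [χ, thickenedIndicator_zero one_pos E hx, hp0]

theorem isFiniteMeasure_of_lintegral_le {Y : Type*} [PseudoMetricSpace Y] [MeasurableSpace Y]
    [BorelSpace Y] {m P : Measure Y} {p : ℝ} (hp : 1 ≤ p) {C : ℝ≥0∞} (hC : C ≠ ∞) {E : Set Y}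
    (hE : P Eᶜ = 0) (hm : m (Metric.thickening 1 E) ≠ ∞)
    (h : ∀ ρ : Y →ᵇ ℝ≥0, ∫⁻ x, ρ x ∂P ≤ C * (∫⁻ x, (ρ x : ℝ≥0∞) ^ p ∂m) ^ (1 / p)) :
    IsFiniteMeasure P := by
  have h1 := lintegral_le_setLIntegral_thickening hp hE h 1
  simp only [BoundedContinuousFunction.coe_one, Pi.one_apply, ENNReal.coe_one, lintegral_one,
    ENNReal.one_rpow, Measure.restrict_apply_univ] at h1
  exact ⟨h1.trans_lt (ENNReal.mul_ne_top hC
    (ENNReal.rpow_ne_top_of_nonneg (by positivity) hm)).lt_top⟩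

/-- An `L^p` bound on the integrals of bounded continuous functions extends to bounded measurable
functions. -/
theorem lintegral_le_of_forall_boundedContinuous {Y : Type*} [PseudoMetricSpace Y]
    [MeasurableSpace Y] [BorelSpace Y] {m P : Measure Y} {p : ℝ} (hp : 1 ≤ p) {C : ℝ≥0∞}
    (hC : C ≠ ∞) {E : Set Y} (hE : P Eᶜ = 0) (hm : m (Metric.thickening 1 E) ≠ ∞)
    (h : ∀ ρ : Y →ᵇ ℝ≥0, ∫⁻ x, ρ x ∂P ≤ C * (∫⁻ x, (ρ x : ℝ≥0∞) ^ p ∂m) ^ (1 / p))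
    {f : Y → ℝ≥0} (hf : Measurable f) {M : ℝ≥0} (hM : ∀ x, f x ≤ M) :
    ∫⁻ x, f x ∂P ≤ C * (∫⁻ x, (f x : ℝ≥0∞) ^ p ∂m) ^ (1 / p) := by
  have hp0 : 0 < p := by linarith
  have hP := isFiniteMeasure_of_lintegral_le hp hC hE hm h
  set B := Metric.thickening 1 E
  have hB : IsFiniteMeasure (m.restrict B) := ⟨by simpa using hm.lt_top⟩
  -- Approximating in `L^p(ν)` controls the error for `m` on `B` and for `P` at once. `D` below is
  -- the Hölder factor from `L^p(P)` to `L^1(P)`.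
  set ν := m.restrict B + P
  have hfm : MemLp (fun x => (f x : ℝ)) (ENNReal.ofReal p) ν :=
    MemLp.of_bound (by fun_prop) M (Eventually.of_forall fun x => by simpa using hM x)
  set D := P univ ^ (1 / (1 : ℝ≥0∞).toReal - 1 / (ENNReal.ofReal p).toReal)
  have hD : D ≠ ∞ := by
    refine ENNReal.rpow_ne_top_of_nonneg ?_ (measure_ne_top P _)
    rw [ENNReal.toReal_ofReal hp0.le, ENNReal.toReal_one, one_div_one, sub_nonneg]
    exact (div_le_one hp0).2 hp
  refine ENNReal.le_of_forall_pos_le_add fun ε hε _ => ?_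
  obtain ⟨δ, hδ, hδε⟩ := ENNReal.exists_nnreal_pos_mul_lt (ENNReal.add_ne_top.2 ⟨hC, hD⟩)
    (b := ε) (by exact_mod_cast hε.ne')
  obtain ⟨g, hg, -⟩ := hfm.exists_boundedContinuous_eLpNorm_sub_le ENNReal.ofReal_ne_top
    (ε := δ) (by exact_mod_cast hδ.ne')
  let r (x : Y) : ℝ≥0 := nndist (f x : ℝ) (g x)
  have hrm : Measurable r := by fun_prop
  have hrs : eLpNorm (fun x => (f x : ℝ) - g x) (ENNReal.ofReal p) ν ≤ δ := hg
  have hr (x : Y) : ‖(f x : ℝ) - g x‖ₑ = r x := by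
    simp only [r, ← edist_nndist, edist_eq_enorm_sub]
  have hrP : ∫⁻ x, r x ∂P ≤ δ * D := by
    have h1 := eLpNorm_le_eLpNorm_mul_rpow_measure_univ (μ := P) (p := 1) (q := ENNReal.ofReal p)
      (f := fun x => (f x : ℝ) - g x) (by simpa using hp) (by fun_prop)
    rw [eLpNorm_one_eq_lintegral_enorm] at h1
    simp_rw [hr] at h1
    refine h1.trans ?_
    gcongr
    exact (eLpNorm_mono_measure _ (Measure.le_add_left le_rfl)).trans hrs
  have hrB : (∫⁻ x in B, (r x : ℝ≥0∞) ^ p ∂m) ^ (1 / p) ≤ δ := by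
    have h1 := (eLpNorm_mono_measure (fun x => (f x : ℝ) - g x)
      (Measure.le_add_right (le_refl (m.restrict B)))).trans hrs
    rw [eLpNorm_eq_lintegral_rpow_enorm_toReal (by simpa using hp0) ENNReal.ofReal_ne_top,
      ENNReal.toReal_ofReal hp0.le] at h1
    simpa only [hr] using h1
  have hgr (x : Y) : f x ≤ g.nnrealPart x + r x ∧ g.nnrealPart x ≤ f x + r x := by
    have h1 : (r x : ℝ) = |(f x : ℝ) - g x| := by simp [r, Real.dist_eq]
    have h2 : (g.nnrealPart x : ℝ) = max (g x) 0 := by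
      simp [BoundedContinuousFunction.nnrealPart_coeFn_eq]
    constructor
    · rw [← NNReal.coe_le_coe, NNReal.coe_add, h1, h2]
      linarith [le_abs_self ((f x : ℝ) - g x), le_max_left (g x) 0]
    · rw [← NNReal.coe_le_coe, NNReal.coe_add, h1, h2]
      refine max_le ?_ (by positivity)
      linarith [neg_le_abs ((f x : ℝ) - g x)]
  have hsum : (∫⁻ x in B, (g.nnrealPart x : ℝ≥0∞) ^ p ∂m) ^ (1 / p) ≤
      (∫⁻ x, (f x : ℝ≥0∞) ^ p ∂m) ^ (1 / p) + δ := by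
    calc _ ≤ (∫⁻ x in B, ((fun x => (f x : ℝ≥0∞)) + fun x => (r x : ℝ≥0∞)) x ^ p ∂m) ^ (1 / p) := by
          gcongr with x
          simpa using ENNReal.coe_le_coe.2 (hgr x).2
      _ ≤ (∫⁻ x in B, (f x : ℝ≥0∞) ^ p ∂m) ^ (1 / p) + (∫⁻ x in B, (r x : ℝ≥0∞) ^ p ∂m) ^ (1 / p) :=
          ENNReal.lintegral_Lp_add_le (by fun_prop) (by fun_prop) hp
      _ ≤ _ := by
          gcongr
          exact Measure.restrict_le_self
  calc ∫⁻ x, f x ∂P ≤ ∫⁻ x, (g.nnrealPart x + r x : ℝ≥0∞) ∂P :=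
        lintegral_mono fun x => by simpa using ENNReal.coe_le_coe.2 (hgr x).1
    _ = ∫⁻ x, g.nnrealPart x ∂P + ∫⁻ x, r x ∂P := lintegral_add_right _ (by fun_prop)
    _ ≤ C * ((∫⁻ x, (f x : ℝ≥0∞) ^ p ∂m) ^ (1 / p) + δ) + δ * D := by
        gcongr
        exact (lintegral_le_setLIntegral_thickening hp hE h _).trans (by gcongr)
    _ = C * (∫⁻ x, (f x : ℝ≥0∞) ^ p ∂m) ^ (1 / p) + δ * (C + D) := by ring
    _ ≤ _ := by gcongr

theorem measure_le_mul_rpow_of_lintegral_le {Y : Type*} [MeasurableSpace Y] {m P : Measure Y}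
    {p : ℝ} (hp : 0 < p) {C : ℝ≥0∞}
    (h : ∀ f : Y → ℝ≥0, Measurable f → (∃ M, ∀ x, f x ≤ M) →
      ∫⁻ x, f x ∂P ≤ C * (∫⁻ x, (f x : ℝ≥0∞) ^ p ∂m) ^ (1 / p)) {A : Set Y} (hA : MeasurableSet A) :
    P A ≤ C * m A ^ (1 / p) := by
  have h1 := h (A.indicator 1) (measurable_one.indicator hA)
    ⟨1, fun x => indicator_le_self' (by simp) x⟩
  have h2 (x : Y) : ((A.indicator (1 : Y → ℝ≥0) x : ℝ≥0) : ℝ≥0∞) = A.indicator (1 : Y → ℝ≥0∞) x := by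
    by_cases hx : x ∈ A <;> simp [hx]
  have h3 (x : Y) : (A.indicator (1 : Y → ℝ≥0∞) x) ^ p = A.indicator 1 x := by
    by_cases hx : x ∈ A <;> simp [hx, hp]
  simpa only [h2, h3, lintegral_indicator_one hA] using h1

theorem absolutelyContinuous_of_lintegral_le {Y : Type*} [MeasurableSpace Y] {m P : Measure Y}
    {p : ℝ} (hp : 0 < p) {C : ℝ≥0∞}
    (h : ∀ f : Y → ℝ≥0, Measurable f → (∃ M, ∀ x, f x ≤ M) →
      ∫⁻ x, f x ∂P ≤ C * (∫⁻ x, (f x : ℝ≥0∞) ^ p ∂m) ^ (1 / p)) : P ≪ m := by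
  refine Measure.AbsolutelyContinuous.mk fun A hA hmA => ?_
  simpa [hmA, hp] using measure_le_mul_rpow_of_lintegral_le hp h hA

theorem eLpNorm_ennreal_eq {Y : Type*} [MeasurableSpace Y] {m : Measure Y} {q : ℝ≥0∞} (h0 : q ≠ 0)
    (htop : q ≠ ∞) (g : Y → ℝ≥0∞) : eLpNorm g q m = (∫⁻ x, g x ^ q.toReal ∂m) ^ (1 / q.toReal) := by
  simp [eLpNorm_eq_lintegral_rpow_enorm_toReal h0 htop]

theorem lintegral_mul_le_mul_eLpNorm {Y : Type*} [MeasurableSpace Y] {m : Measure Y} {p : ℝ}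
    (hp : 1 ≤ p) {q : ℝ≥0∞} (hpq : ENNReal.HolderConjugate (ENNReal.ofReal p) q)
    {f g : Y → ℝ≥0∞} (hf : Measurable f) (hg : Measurable g) :
    ∫⁻ x, f x * g x ∂m ≤ (∫⁻ x, f x ^ p ∂m) ^ (1 / p) * eLpNorm g q m := by
  rcases hp.eq_or_lt with rfl | hp
  · rw [ENNReal.ofReal_one] at hpq
    obtain rfl : q = ∞ := (ENNReal.HolderConjugate.eq_top_iff_eq_one q 1).2 rfl
    simp only [ENNReal.rpow_one, div_one, eLpNorm_exponent_top]
    rw [← lintegral_mul_const _ hf]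
    refine lintegral_mono_ae ?_
    filter_upwards [enorm_ae_le_eLpNormEssSup g m] with x hx
    gcongr
    simpa using hx
  · have hr := ENNReal.HolderConjugate.toReal (p := ENNReal.ofReal p) (q := q)
      (by rwa [ENNReal.toReal_ofReal (by linarith)])
    rw [ENNReal.toReal_ofReal (by linarith)] at hr
    have hq := ENNReal.toReal_pos_iff.1 hr.symm.pos
    rw [eLpNorm_ennreal_eq hq.1.ne' hq.2.ne]
    exact ENNReal.lintegral_mul_le_Lp_mul_Lq m hr hf.aemeasurable hg.aemeasurable

/-- With the truncation `k = min(g, n)`, the test function `k^(q-1)` gives `S ≤ C S^(1/p)` for `S =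
∫ k^q`. Integrability of `g` makes `S` finite, so `S^(1/p)` cancels; then `n → ∞`. -/
theorem lintegral_rpow_le_of_forall_lintegral_mul_le {Y : Type*} [MeasurableSpace Y]
    {m : Measure Y} {p q : ℝ} (hpq : p.HolderConjugate q) {C : ℝ≥0∞} {g : Y → ℝ≥0∞}
    (hg : Measurable g) (hgi : ∫⁻ x, g x ∂m ≠ ∞)
    (h : ∀ f : Y → ℝ≥0, Measurable f → (∃ M, ∀ x, f x ≤ M) →
      ∫⁻ x, g x * f x ∂m ≤ C * (∫⁻ x, (f x : ℝ≥0∞) ^ p ∂m) ^ (1 / p)) :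
    (∫⁻ x, g x ^ q ∂m) ^ (1 / q) ≤ C := by
  have hq0 := hpq.symm.pos
  have hq1 := hpq.symm.lt
  have hp0 := hpq.pos
  let k (n : ℕ) (x : Y) : ℝ≥0 := (min (g x) n).toNNReal
  have hk (n : ℕ) (x : Y) : (k n x : ℝ≥0∞) = min (g x) n :=
    ENNReal.coe_toNNReal (ne_top_of_le_ne_top (ENNReal.natCast_ne_top n) (min_le_right _ _))
  have hkm (n : ℕ) : Measurable (k n) := (hg.min measurable_const).ennreal_toNNReal
  have hkn (n : ℕ) (x : Y) : k n x ≤ n := by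
    have := (hk n x).trans_le (min_le_right _ _)
    exact_mod_cast this
  have hbound (n : ℕ) : ∫⁻ x, (k n x : ℝ≥0∞) ^ q ∂m ≤ C ^ q := by
    set S := ∫⁻ x, (k n x : ℝ≥0∞) ^ q ∂m
    have hpow (x : Y) : (k n x : ℝ≥0∞) ^ q = k n x * (k n x ^ (q - 1) : ℝ≥0) := by
      rw [ENNReal.coe_rpow_of_nonneg _ (by linarith)]
      nth_rw 2 [← ENNReal.rpow_one (k n x : ℝ≥0∞)]
      rw [← ENNReal.rpow_add_of_nonneg _ _ zero_le_one (by linarith)]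
      congr 1; ring
    have hpow' (x : Y) : ((k n x ^ (q - 1) : ℝ≥0) : ℝ≥0∞) ^ p = (k n x : ℝ≥0∞) ^ q := by
      rw [ENNReal.coe_rpow_of_nonneg _ (by linarith), ← ENNReal.rpow_mul, mul_comm,
        hpq.symm.sub_one_mul_conj |> fun h => (mul_comm p (q - 1)).trans h]
    have hle (x : Y) : k n x ^ (q - 1) ≤ (n : ℝ≥0) ^ (q - 1) :=
      NNReal.rpow_le_rpow (hkn n x) (by linarith)
    have hS : S ≤ ∫⁻ x, g x * (k n x ^ (q - 1) : ℝ≥0) ∂m := by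
      refine lintegral_mono fun x => ?_
      rw [hpow]
      gcongr
      exact (hk n x).trans_le (min_le_left _ _)
    have hSC : S ≤ C * S ^ (1 / p) := by
      refine (hS.trans (h _ ((hkm n).pow_const _) ⟨_, hle⟩)).trans_eq ?_
      simp_rw [hpow', S]
    have hStop : S ≠ ∞ := by
      refine ne_top_of_le_ne_top ?_ (hS.trans (lintegral_mono fun x =>
        mul_le_mul_right (ENNReal.coe_le_coe.2 (hle x)) (g x)))
      rw [lintegral_mul_const _ hg]
      exact ENNReal.mul_ne_top hgi ENNReal.coe_ne_top
    rcases eq_or_ne S 0 with hS0 | hS0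
    · simp [hS0]
    have hSp : S ^ (1 / q) * S ^ (1 / p) ≤ C * S ^ (1 / p) := by
      rw [← ENNReal.rpow_add _ _ hS0 hStop, one_div, one_div, hpq.symm.inv_add_inv_eq_one,
        ENNReal.rpow_one]
      simpa only [one_div] using hSC
    have hfin : S ^ (1 / q) ≤ C :=
      (ENNReal.mul_le_mul_iff_left (ENNReal.rpow_pos (pos_iff_ne_zero.2 hS0) hStop).ne'
        (ENNReal.rpow_ne_top_of_nonneg (by positivity) hStop)).1 hSp
    rwa [one_div, ENNReal.rpow_inv_le_iff hq0] at hfin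
  rw [one_div, ENNReal.rpow_inv_le_iff hq0]
  have hlim (x : Y) : Tendsto (fun n => (k n x : ℝ≥0∞) ^ q) atTop (𝓝 (g x ^ q)) := by
    simp_rw [hk]
    refine (ENNReal.continuous_rpow_const.tendsto _).comp ?_
    simpa using (tendsto_const_nhds (x := g x)).min ENNReal.tendsto_nat_nhds_top
  calc ∫⁻ x, g x ^ q ∂m = ∫⁻ x, liminf (fun n => (k n x : ℝ≥0∞) ^ q) atTop ∂m :=
        lintegral_congr fun x => (hlim x).liminf_eq.symm
    _ ≤ liminf (fun n => ∫⁻ x, (k n x : ℝ≥0∞) ^ q ∂m) atTop :=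
        lintegral_liminf_le fun n => by fun_prop
    _ ≤ C ^ q := liminf_le_of_le (by isBoundedDefault) fun b hb => by
        obtain ⟨n, hn⟩ := hb.exists
        exact hn.trans (hbound n)

theorem eLpNorm_rnDeriv_le {Y : Type*} [MeasurableSpace Y] {m P : Measure Y} [SigmaFinite m]
    [IsFiniteMeasure P] {p : ℝ} (hp : 1 ≤ p) {q : ℝ≥0∞}
    (hpq : ENNReal.HolderConjugate (ENNReal.ofReal p) q) {C : ℝ≥0∞}
    (h : ∀ f : Y → ℝ≥0, Measurable f → (∃ M, ∀ x, f x ≤ M) →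
      ∫⁻ x, f x ∂P ≤ C * (∫⁻ x, (f x : ℝ≥0∞) ^ p ∂m) ^ (1 / p)) :
    eLpNorm (P.rnDeriv m) q m ≤ C := by
  have hac := absolutelyContinuous_of_lintegral_le (by linarith) h
  rcases hp.eq_or_lt with rfl | hp
  · rw [ENNReal.ofReal_one] at hpq
    obtain rfl : q = ∞ := (ENNReal.HolderConjugate.eq_top_iff_eq_one q 1).2 rfl
    rw [eLpNorm_exponent_top]
    refine eLpNormEssSup_le_of_ae_enorm_bound ?_
    simp only [enorm_eq_self]
    refine ae_le_of_forall_setLIntegral_le_of_sigmaFinite (g := fun _ => C)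
      (Measure.measurable_rnDeriv P m) fun s hs _ => ?_
    rw [Measure.setLIntegral_rnDeriv hac, setLIntegral_const]
    simpa using measure_le_mul_rpow_of_lintegral_le one_pos h hs
  · have hr := ENNReal.HolderConjugate.toReal (p := ENNReal.ofReal p) (q := q)
      (by rwa [ENNReal.toReal_ofReal (by linarith)])
    rw [ENNReal.toReal_ofReal (by linarith)] at hr
    have hq := ENNReal.toReal_pos_iff.1 hr.symm.pos
    rw [eLpNorm_ennreal_eq hq.1.ne' hq.2.ne]
    refine lintegral_rpow_le_of_forall_lintegral_mul_le hr (Measure.measurable_rnDeriv P m)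
      (Measure.lintegral_rnDeriv_lt_top P m).ne fun f hf hb => ?_
    rw [lintegral_rnDeriv_mul hac (by fun_prop)]
    exact h f hf hb

end Density
end

/-! ### The plan measure: lower bound, disintegration and support. -/

section

variable {X : Type*} [MetricSpace X] [MeasurableSpace X]

theorem modulus_rpow_le_eLpNorm_rnDeriv {m : Measure X} {p : ℝ} (hp : 1 ≤ p) {q : ℝ≥0∞}
    (hpq : ENNReal.HolderConjugate (ENNReal.ofReal p) q) {lam : ℝ≥0∞} {Γ : Set C(I, X)}
    {π : Measure Γ} [IsProbabilityMeasure π] {P : Measure X} [P.HaveLebesgueDecomposition m]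
    (hP : P ≪ m)
    (hint : ∀ f : X → ℝ≥0∞, Measurable f →
      ∫⁻ x, f x ∂P = ∫⁻ γ, energy lam f (γ : C(I, X)) ∂π) :
    modulus m p lam Γ ^ (-(1 / p)) ≤ eLpNorm (P.rnDeriv m) q m := by
  have hp0 : 0 < p := by linarith
  set G := eLpNorm (P.rnDeriv m) q m
  rw [ENNReal.rpow_neg, ENNReal.inv_le_iff_inv_le, one_div, ENNReal.le_rpow_inv_iff hp0]
  refine le_iInf₂ fun ρ hρ => ?_
  have h1 : 1 ≤ (∫⁻ x, ρ x ^ p ∂m) ^ (1 / p) * G := by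
    calc (1 : ℝ≥0∞) = ∫⁻ _, 1 ∂π := by simp
      _ ≤ ∫⁻ γ, energy lam ρ (γ : C(I, X)) ∂π := lintegral_mono fun γ => hρ.2 γ γ.2
      _ = ∫⁻ x, P.rnDeriv m x * ρ x ∂m := by
          rw [← hint ρ hρ.1, lintegral_rnDeriv_mul hP hρ.1.aemeasurable]
      _ ≤ _ := by
          simp_rw [mul_comm (P.rnDeriv m _)]
          exact lintegral_mul_le_mul_eLpNorm hp hpq hρ.1 (Measure.measurable_rnDeriv P m)
  rw [← ENNReal.le_rpow_inv_iff hp0, ← one_div p, ← one_div G]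
  exact ENNReal.div_le_of_le_mul h1

variable [BorelSpace X]

/-- The kernel `γ ↦ γ_# s_γ` is known to be measurable on `Γ`; since `Γ` is closed, its inclusion is
a measurable embedding, which suffices to integrate against the `bind`. -/
theorem lintegral_planMeasure_map {Γ : Set C(I, X)} (hΓ : IsCompact Γ)
    (hrect : ∀ γ ∈ Γ, IsRectifiable γ) (lam : ℝ≥0∞) (π : Measure Γ) {f : X → ℝ≥0∞}
    (hf : Measurable f) :
    ∫⁻ x, f x ∂(planMeasure lam (π.map Subtype.val)) =
      ∫⁻ γ, energy lam f (γ : C(I, X)) ∂π := by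
  have hemb := MeasurableEmbedding.subtype_coe hΓ.isClosed.measurableSet
  have heval (t : I) : Measurable fun γ : C(I, X) => γ t :=
    (ContinuousEvalConst.continuous_eval_const t).measurable
  have hmeas := measurable_map_variationMeasure hrect
  have hmeas' : AEMeasurable (fun γ : C(I, X) => (variationMeasure γ).map γ)
      (π.map Subtype.val) := hemb.aemeasurable_map_iff.2 hmeas.aemeasurable
  have h0 (t : I) : Measurable fun γ : Γ => f ((γ : C(I, X)) t) :=
    hf.comp ((heval t).comp measurable_subtype_coe)
  rw [planMeasure, lintegral_add_measure, lintegral_add_measure, lintegral_smul_measure,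
    lintegral_smul_measure, lintegral_map hf (heval 0), lintegral_map hf (heval 1),
    Measure.lintegral_bind hmeas' hf.aemeasurable, hemb.lintegral_map, hemb.lintegral_map,
    hemb.lintegral_map]
  have h01 : Measurable fun γ : Γ => f ((γ : C(I, X)) 0) + f ((γ : C(I, X)) 1) :=
    (h0 0).add (h0 1)
  simp only [energy]
  rw [lintegral_add_left (h01.const_mul _), lintegral_const_mul _ h01, lintegral_add_left (h0 0), mul_add,
    lintegral_congr fun γ : Γ => lintegral_map_variationMeasure (hrect γ γ.2) hf]
  rfl

/-- The points on curves of `Γ` form the image of the compact `Γ × [0,1]` under evaluation, and no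
energy is seen outside it. -/
theorem exists_isBounded_planMeasure_map_compl_eq_zero {Γ : Set C(I, X)} (hΓ : IsCompact Γ)
    (hrect : ∀ γ ∈ Γ, IsRectifiable γ) (lam : ℝ≥0∞) (π : Measure Γ) :
    ∃ E : Set X, Bornology.IsBounded E ∧ planMeasure lam (π.map Subtype.val) Eᶜ = 0 := by
  have hK : IsCompact ((fun z : C(I, X) × I => z.1 z.2) '' (Γ ×ˢ univ)) :=
    (hΓ.prod isCompact_univ).image (by fun_prop)
  refine ⟨_, hK.isBounded, ?_⟩
  set E := (fun z : C(I, X) × I => z.1 z.2) '' (Γ ×ˢ univ)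
  have hE : MeasurableSet Eᶜ := hK.isClosed.measurableSet.compl
  rw [← lintegral_indicator_one hE, lintegral_planMeasure_map hΓ hrect lam π
    (measurable_one.indicator hE)]
  have h0 (γ : Γ) : energy lam (Eᶜ.indicator 1) (γ : C(I, X)) = 0 := by
    have h1 (t : I) : Eᶜ.indicator (1 : X → ℝ≥0∞) ((γ : C(I, X)) t) = 0 :=
      indicator_of_notMem (not_not.2 ⟨((γ : C(I, X)), t), ⟨γ.2, mem_univ t⟩, rfl⟩) _
    simp [energy, pathIntegral, hrect γ γ.2, h1]
  simp [h0]

theorem sigmaFinite_of_measure_lt_top_of_isBounded {m : Measure X}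
    (hm : ∀ B : Set X, MeasurableSet B → Bornology.IsBounded B → m B < ∞) : SigmaFinite m := by
  rcases isEmpty_or_nonempty X with h | ⟨⟨x⟩⟩
  · rw [Measure.eq_zero_of_isEmpty m]; infer_instance
  · exact ⟨⟨{ set := fun n => Metric.closedBall x n
              set_mem := fun _ => trivial
              finite := fun n => hm _ measurableSet_closedBall Metric.isBounded_closedBall
              spanning := Metric.iUnion_closedBall_nat x }⟩⟩

end

end CurveModulus
end

open CurveModulus in
theorem mainTheorem3 {X : Type*} [MetricSpace X] [CompleteSpace X]
    [TopologicalSpace.SeparableSpace X] [MeasurableSpace X] [BorelSpace X]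
    (m : Measure X)
    (hm : ∀ B : Set X, MeasurableSet B → Bornology.IsBounded B → m B < ∞)
    (p : ℝ) (hp : 1 ≤ p) (q : ℝ≥0∞) (hpq : ENNReal.HolderConjugate (ENNReal.ofReal p) q)
    (lam : ℝ≥0∞) (hlam : lam = 0 ∨ lam = 1)
    (Γ : Set C(I, X)) (hΓ : IsCompact Γ)
    (hrect : ∀ γ ∈ Γ, CurveModulus.IsRectifiable γ)
    (hpos : 0 < CurveModulus.modulus m p lam Γ)
    (hfin : CurveModulus.modulus m p lam Γ < ∞) :
    ∃ π : Measure C(I, X), IsProbabilityMeasure π ∧ π Γᶜ = 0 ∧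
      CurveModulus.HasBarycenter m q lam π ∧
      eLpNorm (CurveModulus.barycenter m lam π) q m =
        CurveModulus.modulus m p lam Γ ^ (-(1 / p)) := by
  have hlam' : lam ≠ ∞ := by rcases hlam with rfl | rfl <;> simp
  lift lam to ℝ≥0 using hlam'
  have hsf := sigmaFinite_of_measure_lt_top_of_isBounded hm
  obtain ⟨π, hπ, hle⟩ := exists_probabilityMeasure_lintegral_energy_le hp lam hΓ hrect hpos hfin
  set C := modulus m p lam Γ ^ (-(1 / p)) with hC
  have hCtop : C ≠ ∞ := by
    rw [hC, ENNReal.rpow_neg]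
    exact ENNReal.inv_ne_top.2 (ENNReal.rpow_pos hpos hfin.ne).ne'
  have hint (f : X → ℝ≥0∞) (hf : Measurable f) :=
    lintegral_planMeasure_map hΓ hrect lam π hf
  set P := planMeasure lam (π.map Subtype.val)
  obtain ⟨E, hE, hPE⟩ := exists_isBounded_planMeasure_map_compl_eq_zero hΓ hrect lam π
  have hmE : m (Metric.thickening 1 E) ≠ ∞ :=
    (hm _ Metric.isOpen_thickening.measurableSet hE.thickening).ne
  have hcont (ρ : X →ᵇ ℝ≥0) :
      ∫⁻ x, ρ x ∂P ≤ C * (∫⁻ x, (ρ x : ℝ≥0∞) ^ p ∂m) ^ (1 / p) :=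
    (hint _ (by fun_prop)).trans_le (hle ρ)
  have hPfin := isFiniteMeasure_of_lintegral_le hp hCtop hPE hmE hcont
  have hbdd (f : X → ℝ≥0) (hf : Measurable f) (hb : ∃ M, ∀ x, f x ≤ M) :
      ∫⁻ x, f x ∂P ≤ C * (∫⁻ x, (f x : ℝ≥0∞) ^ p ∂m) ^ (1 / p) :=
    hb.elim fun _ hM => lintegral_le_of_forall_boundedContinuous hp hCtop hPE hmE hcont hf hM
  have hac := absolutelyContinuous_of_lintegral_le (by linarith) hbdd
  have hnorm : eLpNorm (P.rnDeriv m) q m = C :=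
    (eLpNorm_rnDeriv_le hp hpq hbdd).antisymm (modulus_rpow_le_eLpNorm_rnDeriv hp hpq hac hint)
  have hmeas : AEMeasurable (Subtype.val : Γ → C(I, X)) π := measurable_subtype_coe.aemeasurable
  have hprob : IsProbabilityMeasure (π.map (Subtype.val : Γ → C(I, X))) :=
    Measure.isProbabilityMeasure_map hmeas
  have hconc : π.map (Subtype.val : Γ → C(I, X)) Γᶜ = 0 := by
    rw [Measure.map_apply measurable_subtype_coe hΓ.isClosed.measurableSet.compl]
    simp
  refine ⟨π.map Subtype.val, hprob, hconc, ⟨⟨inferInstance, ?_⟩, hac, ?_, ?_⟩, hnorm⟩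
  · exact measure_mono_null (fun γ hγ hmem => hγ (hrect γ hmem)) hconc
  · exact (Measure.measurable_rnDeriv P m).aestronglyMeasurable
  · exact hnorm.trans_lt hCtop.lt_top
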